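/- Let $n\ge 1$ be an integer, $\mathbf t=(1,n+1)$ and $\mathbf D_0=(x,(n+1)y)^T$. For $k\ge 0$ let $\mathscr P_k$ be the space of real polynomials $f(x,y)$ that are quasi-homogeneous of type $\mathbf t$ and degree $k$, i.e. $f(\epsilon x,\epsilon^{n+1}y)=\epsilon^k f(x,y)$, and let $\mathcal Q_k$ be the space of polynomial vector fields $(P,Q)^T$ with $P\in\mathscr P_{k+1}$ and $Q\in\mathscr P_{k+n+1}$. Let $d\in\mathbb R\setminus\{0\}$ satisfy $|d|\ne 1+\frac{2(n+1)}{k}$ for all integers $k\ge 1$, and put $$\mathbf F_n=\bigl(y+dx^{n+1},\ (n+1)x^{2n+1}+(n+1)dx^ny\bigr)^T\in\mathcal Q_n .$$ For $k>n$ let $\ell_k:\mathscr P_{k-n}\to\mathscr P_k$ be the linear operator $\ell_k(p)=\nabla p\cdot\mathbf F_n$, and let $\mathrm{Cor}(\ell_k)$ be any chosen complementary subspace of $\mathrm{Range}(\ell_k)$ in $\mathscr P_k$. Then every (formal) vector field $\mathbf F=\sum_{j\ge n}\mathbf F_j$ with $\mathbf F_j\in\mathcal Q_j$, whose lowest term is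 the given $\mathbf F_n$, is formally orbitally equivalent to a vector field $$\mathbf G=\mathbf F_n+\sum_{k>n}\mu_k\mathbf D_0,\qquad \mu_k\in\mathrm{Cor}(\ell_k)\ \text{ for all } k>n .$$ Here $\mathbf F$ and $\mathbf G$ are formally orbitally equivalent if there are a formal change of variables $\Phi\in\mathbb R[[x,y]]^2$ with $\Phi(\mathbf 0)=\mathbf 0$ and $\det D\Phi(\mathbf 0)\neq 0$, and a formal power series $\nu\in\mathbb R[[x,y]]$ with $\nu(\mathbf 0)>0$, such that $\Phi_*(\nu\mathbf F)=\mathbf G$, i.e. $D\Phi\cdot(\nu\mathbf F)=\mathbf G\circ\Phi$. -/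

import Mathlib

open scoped MvPowerSeries.WithPiTopology

noncomputable section

namespace QuasiHom

/-- Planar polynomial vector fields with real coefficients; the variable `x` is `X 0` and the
variable `y` is `X 1`. -/
abbrev PolyVF : Type := Fin 2 → MvPolynomial (Fin 2) ℝ

/-- Planar formal vector fields: pairs of real formal power series in `x`, `y`. -/
abbrev FormalVF : Type := Fin 2 → MvPowerSeries (Fin 2) ℝ

/-- The space of quasi-homogeneous polynomials of type `t` and degree `k`. -/
abbrev P (t : Fin 2 → ℕ) (k : ℕ) : Submodule ℝ (MvPolynomial (Fin 2) ℝ) :=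
  MvPolynomial.weightedHomogeneousSubmodule ℝ t k

/-- The space of quasi-homogeneous polynomial vector fields of type `t` and degree `k`: the
`i`-th component is quasi-homogeneous of degree `k + t i`. -/
def Q (t : Fin 2 → ℕ) (k : ℕ) : Submodule ℝ PolyVF :=
  Submodule.pi Set.univ fun i => P t (k + t i)

/-- The dissipative field `D₀ = (t₁ x, t₂ y)`. -/
def D0 (t : Fin 2 → ℕ) : PolyVF := fun i => (t i : MvPolynomial (Fin 2) ℝ) * MvPolynomial.X i

/-- The operator `p ↦ ∇p · V` on polynomials. -/
def gradDot (V : PolyVF) : MvPolynomial (Fin 2) ℝ →ₗ[ℝ] MvPolynomial (Fin 2) ℝ where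
  toFun p := ∑ i, MvPolynomial.pderiv i p * V i
  map_add' p q := by simp only [map_add, add_mul, Finset.sum_add_distrib]
  map_smul' c p := by
    simp only [Derivation.map_smul, smul_mul_assoc, Finset.smul_sum, RingHom.id_apply]

theorem gradDot_mem {t : Fin 2 → ℕ} {n : ℕ} {V : PolyVF} (hV : V ∈ Q t n)
    {j : ℕ} {p : MvPolynomial (Fin 2) ℝ} (hp : p ∈ P t j) : gradDot V p ∈ P t (j + n) := by
  change ∑ i, MvPolynomial.pderiv i p * V i ∈ P t (j + n)
  refine Submodule.sum_mem _ fun i _ => ?_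
  by_cases hi : t i ≤ j
  · have h1 : (MvPolynomial.pderiv i p).IsWeightedHomogeneous t (j - t i) :=
      MvPolynomial.IsWeightedHomogeneous.pderiv hp (Nat.sub_add_cancel hi)
    have h2 : (V i).IsWeightedHomogeneous t (n + t i) := hV i (Set.mem_univ i)
    have h3 := h1.mul h2
    have h4 : j - t i + (n + t i) = j + n := by omega
    rw [h4] at h3
    exact h3
  · have h0 : MvPolynomial.pderiv i p = 0 := by
      ext m
      rw [MvPolynomial.coeff_pderiv, MvPolynomial.coeff_zero]
      by_contra hne
      have h5 := hp (left_ne_zero_of_mul hne)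
      rw [map_add, Finsupp.weight_single] at h5
      simp only [smul_eq_mul, one_mul] at h5
      omega
    rw [h0, zero_mul]
    exact Submodule.zero_mem _

/-- The operator `ℓ_k : P_{k-n} → P_k`, `p ↦ ∇p · V`, attached to a quasi-homogeneous vector
field `V` of degree `n`, for `k ≥ n`. -/
def ell {t : Fin 2 → ℕ} {n : ℕ} {V : PolyVF} (hV : V ∈ Q t n) {k : ℕ} (hk : n ≤ k) :
    P t (k - n) →ₗ[ℝ] P t k :=
  (gradDot V).restrict fun p hp => by
    have h := gradDot_mem hV hp
    rwa [Nat.sub_add_cancel hk] at h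

/-- The type `(1, n+1)`. -/
def typ (n : ℕ) : Fin 2 → ℕ := ![1, n + 1]

open MvPolynomial in
/-- The field `(y + d x^{n+1}, (n+1) x^{2n+1} + (n+1) d x^n y)`. -/
def leadVF (n : ℕ) (d : ℝ) : PolyVF :=
  ![X 1 + C d * X 0 ^ (n + 1),
    C ((n : ℝ) + 1) * X 0 ^ (2 * n + 1) + C (((n : ℝ) + 1) * d) * X 0 ^ n * X 1]

open MvPolynomial in
theorem leadVF_mem (n : ℕ) (d : ℝ) : leadVF n d ∈ Q (typ n) n := by
  have hx : ∀ m : ℕ, (X 0 ^ m : MvPolynomial (Fin 2) ℝ).IsWeightedHomogeneous (typ n) m := by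
    intro m
    have h := (isWeightedHomogeneous_X ℝ (typ n) 0).pow m
    simpa [typ] using h
  have hy : (X 1 : MvPolynomial (Fin 2) ℝ).IsWeightedHomogeneous (typ n) (n + 1) := by
    simpa [typ] using isWeightedHomogeneous_X ℝ (typ n) 1
  have hc : ∀ (c : ℝ) {p : MvPolynomial (Fin 2) ℝ} {m : ℕ}, p.IsWeightedHomogeneous (typ n) m →
      (C c * p).IsWeightedHomogeneous (typ n) m := by
    intro c p m hp
    simpa using (isWeightedHomogeneous_C (typ n) c).mul hp
  intro i _
  fin_cases i
  · exact Submodule.add_mem _ hy (hc d (hx (n + 1)))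
  · refine Submodule.add_mem _ ?_ ?_
    · have h := hc ((n : ℝ) + 1) (hx (2 * n + 1))
      have e : 2 * n + 1 = n + (n + 1) := by omega
      rw [e] at h
      simpa [typ, e] using h
    · exact (hc (((n : ℝ) + 1) * d) (hx n)).mul hy

/-- `F` is the sum of the series of polynomial vector fields `A j`, coefficient by coefficient. -/
def IsFormalSum {ι : Type} (A : ι → PolyVF) (F : FormalVF) : Prop :=
  ∀ i, HasSum (fun j => (A j i : MvPowerSeries (Fin 2) ℝ)) (F i)

/-- (Formal) orbital equivalence of formal planar vector fields: `G = Φ_* (ν F)` for a formal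
diffeomorphism `Φ` fixing the origin and a formal time rescaling `ν` with `ν(0) > 0`, that is,
`DΦ · (ν F) = G ∘ Φ`. -/
def OrbitallyEquivalent (F G : FormalVF) : Prop :=
  ∃ (Φ : Fin 2 → MvPowerSeries (Fin 2) ℝ) (ν : MvPowerSeries (Fin 2) ℝ),
    (∀ i, MvPowerSeries.constantCoeff (Φ i) = 0) ∧
    (Matrix.of fun i j => MvPowerSeries.constantCoeff (MvPowerSeries.pderiv ℝ j (Φ i))).det ≠ 0 ∧
    0 < MvPowerSeries.constantCoeff ν ∧
    ∀ i, ∑ j, MvPowerSeries.pderiv ℝ j (Φ i) * (ν * F j) = MvPowerSeries.subst Φ (G i)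

end QuasiHom

end

/-! Normalise weight by weight. If `(Φ, ν)` conjugates `F` to `G` up to degree `k = r + 1 + n`,
adding `U`, `ν₀` of degree `r + 1` to `Φ`, `ν` and `μ D₀` to `G` changes the degree `k` defect by
`[F_n, U] + ν₀ F_n - μ D₀`. So everything reduces to the homological equation: these fields, with `μ
∈ Cor(ℓ_k)`, must fill `Q_k` (`Q_le_homologicalRange`).

Three observations solve it. By Euler's identity `[F_n, p D₀] = ℓ_k(p) D₀ - n p F_n`, so every
multiple of `D₀` is reached, not only those with coefficient in `Cor(ℓ_k)`. Next, `F_n = H + d x^n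
D₀` with `H = (y, (n+1) x^(2n+1))`, so every multiple of `H` is reached too. Modulo multiples of
`D₀` and `H`, each field of degree `k` reduces to a combination of `(0, x^(r+2n+2))` and `(0,
x^(r+n+1) y)`. The brackets of `F_n` with `(0, x^(r+n+2))` and `(0, x^(r+1) y)` give two relations
between these, with determinant `(r+2n+3)² - d²(r+1)²`, nonzero exactly when `|d| ≠ 1 +
2(n+1)/(r+1)`.

The corrections have increasing weight, so `Φ`, `ν` and `G` converge in the weight filtration and
the limiting defect vanishes. -/

noncomputable section

namespace QuasiHom

/-! ### The filtration of power series by weight. -/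

section WeightIdeal

variable {σ R : Type*} [CommRing R] (w : σ → ℕ)

/-- The ideal of formal power series all of whose monomials have `w`-weight at least `N`. -/
def weightIdeal (N : ℕ) : Ideal (MvPowerSeries σ R) where
  carrier := {f | (N : ℕ∞) ≤ f.weightedOrder w}
  add_mem' hf hg := (le_min hf hg).trans (MvPowerSeries.min_weightedOrder_le_add w)
  zero_mem' := by simp
  smul_mem' c _ hf :=
    (hf.trans le_add_self).trans (MvPowerSeries.le_weightedOrder_mul w (f := c))

variable {w}

theorem mem_weightIdeal {N : ℕ} {f : MvPowerSeries σ R} :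
    f ∈ weightIdeal w N ↔ ∀ m, Finsupp.weight w m < N → MvPowerSeries.coeff m f = 0 :=
  ⟨fun h _ hm => MvPowerSeries.coeff_eq_zero_of_lt_weightedOrder w
    (lt_of_lt_of_le (Nat.cast_lt.mpr hm) h), fun h => MvPowerSeries.nat_le_weightedOrder w h⟩

theorem weightIdeal_anti {M N : ℕ} (h : M ≤ N) {f : MvPowerSeries σ R}
    (hf : f ∈ weightIdeal w N) : f ∈ weightIdeal w M :=
  mem_weightIdeal.mpr fun m hm => mem_weightIdeal.mp hf m (hm.trans_le h)

theorem mem_weightIdeal_zero (f : MvPowerSeries σ R) : f ∈ weightIdeal w 0 :=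
  mem_weightIdeal.mpr fun _ h => absurd h (Nat.not_lt_zero _)

theorem mul_mem_weightIdeal {M N : ℕ} {f g : MvPowerSeries σ R} (hf : f ∈ weightIdeal w M)
    (hg : g ∈ weightIdeal w N) : f * g ∈ weightIdeal w (M + N) := by
  change ((M + N : ℕ) : ℕ∞) ≤ _
  rw [Nat.cast_add]
  exact (add_le_add hf hg).trans (MvPowerSeries.le_weightedOrder_mul w)

theorem coe_mem_weightIdeal {N : ℕ} {p : MvPolynomial σ R} (hp : p.IsWeightedHomogeneous w N) :
    (p : MvPowerSeries σ R) ∈ weightIdeal w N :=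
  mem_weightIdeal.mpr fun m hm => by
    rw [MvPolynomial.coeff_coe]
    by_contra h
    exact hm.ne (hp h)

theorem X_mem_weightIdeal (w : σ → ℕ) (i : σ) :
    (MvPowerSeries.X i : MvPowerSeries σ R) ∈ weightIdeal w (w i) := by
  simpa using coe_mem_weightIdeal (MvPolynomial.isWeightedHomogeneous_X R w i)

theorem mem_weightIdeal_of_sub {M N : ℕ} (h : M ≤ N) {f g : MvPowerSeries σ R}
    (hfg : f - g ∈ weightIdeal w N) (hg : g ∈ weightIdeal w M) : f ∈ weightIdeal w M := by
  simpa using add_mem (weightIdeal_anti h hfg) hg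

theorem eq_zero_of_forall_mem_weightIdeal {f : MvPowerSeries σ R}
    (h : ∀ N, f ∈ weightIdeal w N) : f = 0 := by
  ext m
  exact mem_weightIdeal.mp (h (Finsupp.weight w m + 1)) m (Nat.lt_succ_self _)

/-- Completeness of the weight filtration. -/
theorem exists_limit_weightIdeal (f : ℕ → MvPowerSeries σ R) (c : ℕ)
    (h : ∀ r, f (r + 1) - f r ∈ weightIdeal w (r + c)) :
    ∃ g, ∀ r, g - f r ∈ weightIdeal w (r + c) := by
  have hmono : ∀ r s, f (r + s) - f r ∈ weightIdeal w (r + c) := by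
    intro r s
    induction s with
    | zero => simp
    | succ s ih =>
      have := add_mem (weightIdeal_anti (by omega) (h (r + s))) ih
      rwa [sub_add_sub_cancel] at this
  -- The coefficient at `m` no longer changes once the index exceeds the weight of `m`.
  refine ⟨fun m => MvPowerSeries.coeff m (f (Finsupp.weight w m + 1)), fun r => ?_⟩
  rw [mem_weightIdeal]
  intro m hm
  change MvPowerSeries.coeff m (f (Finsupp.weight w m + 1)) - MvPowerSeries.coeff m (f r) = 0
  rcases le_total (Finsupp.weight w m + 1) r with hr | hr <;>
    obtain ⟨s, hs⟩ := Nat.exists_eq_add_of_le hr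
  · have := mem_weightIdeal.mp (hmono (Finsupp.weight w m + 1) s) m (by omega)
    rw [← hs, map_sub] at this
    rw [← neg_sub, this, neg_zero]
  · have := mem_weightIdeal.mp (hmono r s) m hm
    rwa [← hs, map_sub] at this

/-- The lowest weighted homogeneous component of a power series is a polynomial. -/
theorem exists_leading_part [Finite σ] (hw : ∀ i, w i ≠ 0) {N : ℕ} {f : MvPowerSeries σ R}
    (hf : f ∈ weightIdeal w N) :
    ∃ p : MvPolynomial σ R, p.IsWeightedHomogeneous w N ∧
      f - (p : MvPowerSeries σ R) ∈ weightIdeal w (N + 1) := by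
  classical
  have hfin : Set.Finite {m : σ →₀ ℕ | Finsupp.weight w m ≤ N} :=
    Finsupp.finite_of_nat_weight_le w hw N
  let s := hfin.toFinset.filter fun m => Finsupp.weight w m = N
  refine ⟨∑ m ∈ s, MvPolynomial.monomial m (MvPowerSeries.coeff m f), ?_, ?_⟩
  · exact Submodule.sum_mem (MvPolynomial.weightedHomogeneousSubmodule R w N) fun m hm =>
      MvPolynomial.isWeightedHomogeneous_monomial w m _ (Finset.mem_filter.mp hm).2
  · rw [mem_weightIdeal]
    intro m hm
    rw [map_sub, MvPolynomial.coeff_coe, MvPolynomial.coeff_sum]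
    simp only [MvPolynomial.coeff_monomial, Finset.sum_ite_eq']
    split_ifs with h
    · exact sub_self _
    · rw [sub_zero]
      refine mem_weightIdeal.mp hf m (lt_of_le_of_ne (Nat.lt_succ_iff.mp hm) fun he => h ?_)
      simp [s, he]

end WeightIdeal

/-! ### Substitution and partial derivatives in the filtration. -/

section Subst

variable {σ R : Type*} [CommRing R] {w : σ → ℕ} {Φ Ψ : σ → MvPowerSeries σ R}

theorem pow_mem_weightIdeal {N : ℕ} {f : MvPowerSeries σ R} (hf : f ∈ weightIdeal w N) (m : ℕ) :
    f ^ m ∈ weightIdeal w (m * N) := by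
  induction m with
  | zero => simpa using mem_weightIdeal_zero _
  | succ m ih => rw [pow_succ, add_mul, one_mul]; exact mul_mem_weightIdeal ih hf

theorem pow_sub_pow_mem_weightIdeal {N r : ℕ} {f g : MvPowerSeries σ R}
    (hf : f ∈ weightIdeal w N) (hg : g ∈ weightIdeal w N) (h : g - f ∈ weightIdeal w (N + r))
    (m : ℕ) : g ^ m - f ^ m ∈ weightIdeal w (m * N + r) := by
  induction m with
  | zero => simp
  | succ m ih =>
    have h1 := mul_mem_weightIdeal ih hg
    have h2 := mul_mem_weightIdeal (pow_mem_weightIdeal hf m) h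
    have e : g ^ (m + 1) - f ^ (m + 1) = (g ^ m - f ^ m) * g + f ^ m * (g - f) := by ring
    rw [e]
    refine add_mem (weightIdeal_anti ?_ h1) (weightIdeal_anti ?_ h2) <;> (rw [add_mul]; omega)

theorem prod_pow_mem_weightIdeal (hΦ : ∀ i, Φ i ∈ weightIdeal w (w i)) (m : σ →₀ ℕ) :
    (m.prod fun i e => Φ i ^ e) ∈ weightIdeal w (Finsupp.weight w m) := by
  classical
  induction m using Finsupp.induction_linear with
  | zero => simpa using mem_weightIdeal_zero _
  | add a b ha hb =>
    rw [Finsupp.prod_add_index' (by simp) (fun i => pow_add _), map_add]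
    exact mul_mem_weightIdeal ha hb
  | single i e =>
    rw [Finsupp.prod_single_index (by simp), Finsupp.weight_single, smul_eq_mul]
    exact pow_mem_weightIdeal (hΦ i) e

theorem prod_pow_sub_mem_weightIdeal {r : ℕ} (hΦ : ∀ i, Φ i ∈ weightIdeal w (w i))
    (hΨ : ∀ i, Ψ i ∈ weightIdeal w (w i)) (h : ∀ i, Ψ i - Φ i ∈ weightIdeal w (w i + r))
    (m : σ →₀ ℕ) :
    (m.prod fun i e => Ψ i ^ e) - (m.prod fun i e => Φ i ^ e) ∈
      weightIdeal w (Finsupp.weight w m + r) := by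
  classical
  induction m using Finsupp.induction_linear with
  | zero => simp
  | add a b ha hb =>
    rw [Finsupp.prod_add_index' (by simp) (fun i => pow_add _),
      Finsupp.prod_add_index' (by simp) (fun i => pow_add _), map_add]
    have h1 := mul_mem_weightIdeal ha (prod_pow_mem_weightIdeal hΨ b)
    have h2 := mul_mem_weightIdeal (prod_pow_mem_weightIdeal hΦ a) hb
    have h3 := add_mem (weightIdeal_anti (show Finsupp.weight w a + Finsupp.weight w b + r ≤ _ by
      omega) h1) (weightIdeal_anti (by omega) h2)
    convert h3 using 1
    ring
  | single i e =>
    rw [Finsupp.prod_single_index (by simp), Finsupp.prod_single_index (by simp),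
      Finsupp.weight_single, smul_eq_mul]
    exact pow_sub_pow_mem_weightIdeal (hΦ i) (hΨ i) (h i) e

theorem subst_mem_weightIdeal (hs : MvPowerSeries.HasSubst Φ)
    (hΦ : ∀ i, Φ i ∈ weightIdeal w (w i)) {N : ℕ} {f : MvPowerSeries σ R}
    (hf : f ∈ weightIdeal w N) : MvPowerSeries.subst Φ f ∈ weightIdeal w N := by
  rw [mem_weightIdeal]
  intro m hm
  rw [MvPowerSeries.coeff_subst hs, finsum_eq_zero_of_forall_eq_zero]
  intro e
  rcases lt_or_ge (Finsupp.weight w e) N with he | he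
  · rw [mem_weightIdeal.mp hf e he, zero_smul]
  · rw [mem_weightIdeal.mp (prod_pow_mem_weightIdeal hΦ e) m (by omega), smul_zero]

/-- Lipschitz estimate for composition. It suffices for the higher terms of `G`; only the leading
field needs a Taylor expansion. -/
theorem subst_sub_subst_mem_weightIdeal (hsΦ : MvPowerSeries.HasSubst Φ)
    (hsΨ : MvPowerSeries.HasSubst Ψ) {r : ℕ} (hΦ : ∀ i, Φ i ∈ weightIdeal w (w i))
    (hΨ : ∀ i, Ψ i ∈ weightIdeal w (w i)) (h : ∀ i, Ψ i - Φ i ∈ weightIdeal w (w i + r))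
    {N : ℕ} {f : MvPowerSeries σ R} (hf : f ∈ weightIdeal w N) :
    MvPowerSeries.subst Ψ f - MvPowerSeries.subst Φ f ∈ weightIdeal w (N + r) := by
  rw [mem_weightIdeal]
  intro m hm
  rw [map_sub, MvPowerSeries.coeff_subst hsΨ, MvPowerSeries.coeff_subst hsΦ,
    ← finsum_sub_distrib (MvPowerSeries.coeff_subst_finite hsΨ f m)
      (MvPowerSeries.coeff_subst_finite hsΦ f m), finsum_eq_zero_of_forall_eq_zero]
  intro e
  rcases lt_or_ge (Finsupp.weight w e) N with he | he
  · rw [mem_weightIdeal.mp hf e he, zero_smul, zero_smul, sub_zero]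
  · rw [← smul_sub, ← map_sub,
      mem_weightIdeal.mp (prod_pow_sub_mem_weightIdeal hΦ hΨ h e) m (by omega), smul_zero]

theorem constantCoeff_eq_zero_of_mem_weightIdeal (hw : ∀ i, w i ≠ 0)
    (hΦ : ∀ i, Φ i ∈ weightIdeal w (w i)) (i : σ) : MvPowerSeries.constantCoeff (Φ i) = 0 := by
  rw [← MvPowerSeries.coeff_zero_eq_constantCoeff_apply]
  exact mem_weightIdeal.mp (hΦ i) 0 (by simpa using Nat.pos_of_ne_zero (hw i))

/-- The truncated subtraction is harmless: for `N ≤ w i` the bound is vacuous. -/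
theorem pderiv_mem_weightIdeal {N : ℕ} {f : MvPowerSeries σ R} (hf : f ∈ weightIdeal w N) (i : σ) :
    MvPowerSeries.pderiv R i f ∈ weightIdeal w (N - w i) := by
  rw [mem_weightIdeal]
  intro m hm
  rw [MvPowerSeries.coeff_pderiv, mem_weightIdeal.mp hf, zero_mul]
  rw [map_add, Finsupp.weight_single, one_smul]
  omega

end Subst

/-! ### Derivation along a formal field and Taylor expansion. -/

section FieldDeriv

variable {σ R : Type*} [Fintype σ] [CommRing R] {w : σ → ℕ}

/-- The derivation `f ↦ ∇f · V` of formal power series along a formal vector field `V`. -/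
def fieldDeriv (V : σ → MvPowerSeries σ R) : MvPowerSeries σ R →ₗ[R] MvPowerSeries σ R where
  toFun f := ∑ i, MvPowerSeries.pderiv R i f * V i
  map_add' p q := by simp only [map_add, add_mul, Finset.sum_add_distrib]
  map_smul' c p := by
    simp only [Derivation.map_smul, smul_mul_assoc, Finset.smul_sum, RingHom.id_apply]

theorem fieldDeriv_apply (V : σ → MvPowerSeries σ R) (f : MvPowerSeries σ R) :
    fieldDeriv V f = ∑ i, MvPowerSeries.pderiv R i f * V i := rfl

theorem fieldDeriv_mul (V : σ → MvPowerSeries σ R) (f g : MvPowerSeries σ R) :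
    fieldDeriv V (f * g) = fieldDeriv V f * g + f * fieldDeriv V g := by
  simp only [fieldDeriv_apply, Derivation.leibniz, smul_eq_mul, Finset.sum_mul, Finset.mul_sum,
    ← Finset.sum_add_distrib]
  exact Finset.sum_congr rfl fun i _ => by ring

theorem fieldDeriv_C (V : σ → MvPowerSeries σ R) (c : R) :
    fieldDeriv V (MvPowerSeries.C c) = 0 := by
  simp [fieldDeriv_apply]

theorem fieldDeriv_X (V : σ → MvPowerSeries σ R) (i : σ) :
    fieldDeriv V (MvPowerSeries.X i) = V i := by
  classical
  rw [fieldDeriv_apply, Finset.sum_eq_single i]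
  · simp
  · intro j _ hj
    rw [MvPowerSeries.pderiv_X_of_ne hj.symm, zero_mul]
  · simp

theorem fieldDeriv_sub_left (V W : σ → MvPowerSeries σ R) (f : MvPowerSeries σ R) :
    fieldDeriv (fun i => V i - W i) f = fieldDeriv V f - fieldDeriv W f := by
  simp only [fieldDeriv_apply, mul_sub, Finset.sum_sub_distrib]

theorem fieldDeriv_mem_weightIdeal {M N : ℕ} {V : σ → MvPowerSeries σ R}
    {f : MvPowerSeries σ R} (hf : f ∈ weightIdeal w N) (hV : ∀ i, V i ∈ weightIdeal w (M + w i)) :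
    fieldDeriv V f ∈ weightIdeal w (N + M) :=
  sum_mem fun i _ => weightIdeal_anti (by omega)
    (mul_mem_weightIdeal (pderiv_mem_weightIdeal hf i) (hV i))

/-- First order Taylor expansion of a weighted homogeneous polynomial. -/
theorem aeval_sub_aeval_sub_fieldDeriv_mem {Φ Ψ : σ → MvPowerSeries σ R} {r : ℕ} (hr : 1 ≤ r)
    (hΦ : ∀ i, Φ i - MvPowerSeries.X i ∈ weightIdeal w (w i + 1))
    (h : ∀ i, Ψ i - Φ i ∈ weightIdeal w (w i + r)) {N : ℕ} {p : MvPolynomial σ R}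
    (hp : p.IsWeightedHomogeneous w N) :
    MvPolynomial.aeval Ψ p - MvPolynomial.aeval Φ p - fieldDeriv (fun i => Ψ i - Φ i) p ∈
      weightIdeal w (N + r + 1) := by
  classical
  have hX := X_mem_weightIdeal (R := R) w
  have hΦ' : ∀ i, Φ i ∈ weightIdeal w (w i) := fun i =>
    mem_weightIdeal_of_sub (Nat.le_succ _) (hΦ i) (hX i)
  have hΨ' : ∀ i, Ψ i ∈ weightIdeal w (w i) := fun i =>
    mem_weightIdeal_of_sub (Nat.le_add_right _ _) (h i) (hΦ' i)
  -- The derivative is taken at the identity rather than at `Φ`; the discrepancy has higher weight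
  -- because `Φ` is the identity to leading order.
  have key : ∀ m : σ →₀ ℕ, (m.prod fun i e => Ψ i ^ e) - (m.prod fun i e => Φ i ^ e) -
      fieldDeriv (fun i => Ψ i - Φ i) (m.prod fun i e => MvPowerSeries.X i ^ e) ∈
        weightIdeal w (Finsupp.weight w m + r + 1) := by
    have hmul : ∀ (a b a' b' x y : MvPowerSeries σ R) (A B : ℕ), b ∈ weightIdeal w B →
        x ∈ weightIdeal w A → a - x ∈ weightIdeal w (A + 1) →
        b - y ∈ weightIdeal w (B + 1) → a' - a ∈ weightIdeal w (A + r) →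
        b' - b ∈ weightIdeal w (B + r) →
        a' - a - fieldDeriv (fun i => Ψ i - Φ i) x ∈ weightIdeal w (A + r + 1) →
        b' - b - fieldDeriv (fun i => Ψ i - Φ i) y ∈ weightIdeal w (B + r + 1) →
        a' * b' - a * b - fieldDeriv (fun i => Ψ i - Φ i) (x * y) ∈
          weightIdeal w (A + B + r + 1) := by
      intro a b a' b' x y A B hb hx hax hby haa hbb ha2 hb2
      have hDx : fieldDeriv (fun i => Ψ i - Φ i) x ∈ weightIdeal w (A + r) :=
        fieldDeriv_mem_weightIdeal hx fun i => weightIdeal_anti (by omega) (h i)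
      have e : a' * b' - a * b - fieldDeriv (fun i => Ψ i - Φ i) (x * y) =
          (a' - a - fieldDeriv (fun i => Ψ i - Φ i) x) * b +
          fieldDeriv (fun i => Ψ i - Φ i) x * (b - y) +
          x * (b' - b - fieldDeriv (fun i => Ψ i - Φ i) y) +
          (a - x) * (b' - b) + (a' - a) * (b' - b) := by
        rw [fieldDeriv_mul]; ring
      rw [e]
      refine add_mem (add_mem (add_mem (add_mem ?_ ?_) ?_) ?_) ?_
      · exact weightIdeal_anti (by omega) (mul_mem_weightIdeal ha2 hb)
      · exact weightIdeal_anti (by omega) (mul_mem_weightIdeal hDx hby)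
      · exact weightIdeal_anti (by omega) (mul_mem_weightIdeal hx hb2)
      · exact weightIdeal_anti (by omega) (mul_mem_weightIdeal hax hbb)
      -- The quadratic term has weight `A + B + 2r`; this is where `1 ≤ r` enters.
      · exact weightIdeal_anti (by omega) (mul_mem_weightIdeal haa hbb)
    intro m
    induction m using Finsupp.induction_linear with
    | zero =>
      have := fieldDeriv_C (fun i => Ψ i - Φ i) (1 : R)
      rw [map_one] at this
      simp [this]
    | add a b ha hb =>
      simp only [Finsupp.prod_add_index' (h := fun i e => Ψ i ^ e) (by simp) (fun i => pow_add _),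
        Finsupp.prod_add_index' (h := fun i e => Φ i ^ e) (by simp) (fun i => pow_add _),
        Finsupp.prod_add_index' (h := fun i e => (MvPowerSeries.X i : MvPowerSeries σ R) ^ e)
          (by simp) (fun i => pow_add _), map_add]
      exact hmul _ _ _ _ _ _ _ _ (prod_pow_mem_weightIdeal hΦ' b) (prod_pow_mem_weightIdeal hX a)
        (prod_pow_sub_mem_weightIdeal hX hΦ' hΦ a) (prod_pow_sub_mem_weightIdeal hX hΦ' hΦ b)
        (prod_pow_sub_mem_weightIdeal hΦ' hΨ' h a) (prod_pow_sub_mem_weightIdeal hΦ' hΨ' h b) ha hb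
    | single i e =>
      rw [Finsupp.prod_single_index (by simp), Finsupp.prod_single_index (by simp),
        Finsupp.prod_single_index (by simp), Finsupp.weight_single, smul_eq_mul]
      induction e with
      | zero =>
        have := fieldDeriv_C (fun i => Ψ i - Φ i) (1 : R)
        rw [map_one] at this
        simp [this]
      | succ e ih =>
        rw [pow_succ, pow_succ, pow_succ, add_mul, one_mul]
        refine hmul _ _ _ _ _ _ _ _ (hΦ' i) (pow_mem_weightIdeal (hX i) e)
          (pow_sub_pow_mem_weightIdeal (hX i) (hΦ' i) (hΦ i) e) (hΦ i)
          (pow_sub_pow_mem_weightIdeal (hΦ' i) (hΨ' i) (h i) e) (h i) ih ?_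
        rw [fieldDeriv_X]
        simp
  induction hp using MvPolynomial.IsWeightedHomogeneous.induction_on with
  | zero => simp
  | add p q _ _ hp hq =>
    have := add_mem hp hq
    convert this using 1
    simp only [map_add, MvPolynomial.coe_add]
    ring
  | monomial m c hm =>
    have := Ideal.mul_mem_left _ (MvPowerSeries.C c) (key m)
    rw [hm] at this
    convert this using 1
    have e : ((MvPolynomial.monomial m c : MvPolynomial σ R) : MvPowerSeries σ R) =
        c • (m.prod fun i e => MvPowerSeries.X i ^ e) := by
      rw [MvPolynomial.coe_monomial, ← MvPowerSeries.monomial_one_eq, ← map_smul, smul_eq_mul,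
        mul_one]
    rw [e, LinearMap.map_smul, MvPolynomial.aeval_monomial, MvPolynomial.aeval_monomial,
      MvPowerSeries.smul_eq_C_mul]
    simp only [MvPowerSeries.algebraMap_apply, Algebra.algebraMap_self, RingHom.id_apply]
    ring

end FieldDeriv

/-! ### The homological equation. -/

section Homological

theorem gradDot_apply (V : PolyVF) (p : MvPolynomial (Fin 2) ℝ) :
    gradDot V p = MvPolynomial.pderiv 0 p * V 0 + MvPolynomial.pderiv 1 p * V 1 :=
  show ∑ i, MvPolynomial.pderiv i p * V i = _ from Fin.sum_univ_two _

theorem single_zero_eq (f : MvPolynomial (Fin 2) ℝ) : Pi.single 0 f = ![f, 0] := by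
  funext i; fin_cases i <;> simp

theorem single_one_eq (f : MvPolynomial (Fin 2) ℝ) : Pi.single 1 f = ![0, f] := by
  funext i; fin_cases i <;> simp

theorem mem_Q {t : Fin 2 → ℕ} {k : ℕ} {V : PolyVF} : V ∈ Q t k ↔ ∀ i, V i ∈ P t (k + t i) :=
  ⟨fun h i => h i (Set.mem_univ i), fun h i _ => h i⟩

/-- Euler's identity: `D₀` multiplies a quasi-homogeneous polynomial by its degree. -/
theorem gradDot_D0 {t : Fin 2 → ℕ} {k : ℕ} {p : MvPolynomial (Fin 2) ℝ} (hp : p ∈ P t k) :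
    gradDot (D0 t) p = (k : MvPolynomial (Fin 2) ℝ) * p := by
  have h := MvPolynomial.IsWeightedHomogeneous.sum_weight_X_mul_pderiv hp
  rw [nsmul_eq_mul] at h
  rw [← h, gradDot_apply, Fin.sum_univ_two]
  simp only [nsmul_eq_mul, D0]
  ring

/-- The Lie bracket of `V` and `U`, in the convention `DU · V - DV · U`. -/
def lieBracket (V U : PolyVF) : PolyVF := fun i => gradDot V (U i) - gradDot U (V i)

/-- Euler's identity on the components of `V` gives `[V, D₀] = -n V`; the other term comes from
differentiating `p`. -/
theorem lieBracket_mul_D0 {t : Fin 2 → ℕ} {n : ℕ} {V : PolyVF} (hV : V ∈ Q t n)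
    (p : MvPolynomial (Fin 2) ℝ) (i : Fin 2) :
    lieBracket V (fun j => p * D0 t j) i =
      gradDot V p * D0 t i - (n : MvPolynomial (Fin 2) ℝ) * p * V i := by
  have h1 : gradDot (fun j => p * D0 t j) (V i) = p * gradDot (D0 t) (V i) := by
    simp only [gradDot_apply]; ring
  have h2 : gradDot V (p * D0 t i) = gradDot V p * D0 t i + p * gradDot V (D0 t i) := by
    simp only [gradDot_apply, Derivation.leibniz, smul_eq_mul]; ring
  have h3 : gradDot V (D0 t i) = (t i : MvPolynomial (Fin 2) ℝ) * V i := by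
    rw [gradDot_apply]
    fin_cases i <;> simp [D0, Derivation.leibniz, MvPolynomial.pderiv_X]
  rw [lieBracket, h1, h2, h3, gradDot_D0 (mem_Q.mp hV i)]
  push_cast
  ring

/-- The fields of degree `k` that the linearised change of variables `U`, time change `ν` and
field `μ D₀` with `μ ∈ C` generate. -/
def homologicalRange (t : Fin 2 → ℕ) (V : PolyVF) (s : ℕ)
    (C : Submodule ℝ (MvPolynomial (Fin 2) ℝ)) : Submodule ℝ PolyVF where
  carrier := {W | ∃ U ∈ Q t s, ∃ ν ∈ P t s, ∃ μ ∈ C,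
    ∀ i, W i = lieBracket V U i + ν * V i + μ * D0 t i}
  zero_mem' := ⟨0, zero_mem _, 0, zero_mem _, 0, zero_mem _, fun i => by
    simp [lieBracket, gradDot_apply]⟩
  add_mem' := by
    rintro W W' ⟨U, hU, ν, hν, μ, hμ, h⟩ ⟨U', hU', ν', hν', μ', hμ', h'⟩
    refine ⟨U + U', add_mem hU hU', ν + ν', add_mem hν hν', μ + μ', add_mem hμ hμ', fun i => ?_⟩
    rw [Pi.add_apply, h, h']
    simp only [lieBracket, gradDot_apply, Pi.add_apply, map_add]
    ring
  smul_mem' := by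
    rintro c W ⟨U, hU, ν, hν, μ, hμ, h⟩
    refine ⟨c • U, Submodule.smul_mem _ c hU, c • ν, Submodule.smul_mem _ c hν, c • μ,
      Submodule.smul_mem _ c hμ, fun i => ?_⟩
    rw [Pi.smul_apply, h]
    simp only [lieBracket, gradDot_apply, Pi.smul_apply, Derivation.map_smul]
    simp only [MvPolynomial.smul_eq_C_mul]
    ring

variable {n : ℕ} {d : ℝ} {r : ℕ} {C : Submodule ℝ (MvPolynomial (Fin 2) ℝ)}

theorem mul_D0_mem {k : ℕ} {μ : MvPolynomial (Fin 2) ℝ} (hμ : μ ∈ P (typ n) k) (i : Fin 2) :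
    μ * D0 (typ n) i ∈ P (typ n) (k + typ n i) := by
  have h := MvPolynomial.IsWeightedHomogeneous.mul hμ
    ((MvPolynomial.isWeightedHomogeneous_X ℝ (typ n) i).C_mul (typ n i : ℝ))
  rwa [map_natCast] at h

theorem monomial_mem_P {a b k : ℕ} (h : a + (n + 1) * b = k) :
    (MvPolynomial.X 0 ^ a * MvPolynomial.X 1 ^ b : MvPolynomial (Fin 2) ℝ) ∈ P (typ n) k := by
  have h0 := (MvPolynomial.isWeightedHomogeneous_X ℝ (typ n) 0).pow a
  have h1 := (MvPolynomial.isWeightedHomogeneous_X ℝ (typ n) 1).pow b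
  have h2 := h0.mul h1
  have e : a • typ n 0 + b • typ n 1 = k := by simp [typ, ← h, mul_comm]
  rwa [e] at h2

theorem P_le_of_monomial_mem {k : ℕ} {S : Submodule ℝ (MvPolynomial (Fin 2) ℝ)}
    (h : ∀ a b, a + (n + 1) * b = k → MvPolynomial.X 0 ^ a * MvPolynomial.X 1 ^ b ∈ S) :
    P (typ n) k ≤ S := by
  intro p hp
  induction hp using MvPolynomial.IsWeightedHomogeneous.induction_on with
  | zero => exact zero_mem _
  | add p q _ _ hp hq => exact add_mem hp hq
  | monomial m c hm =>
    have e : MvPolynomial.monomial m c = c • (MvPolynomial.X 0 ^ m 0 * MvPolynomial.X 1 ^ m 1) := by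
      rw [MvPolynomial.monomial_eq, Finsupp.prod_fintype _ _ (by simp), Fin.prod_univ_two,
        MvPolynomial.smul_eq_C_mul]
    rw [e]
    refine Submodule.smul_mem _ c (h _ _ ?_)
    rw [← hm, Finsupp.weight_apply, Finsupp.sum_fintype _ _ (by simp), Fin.sum_univ_two]
    simp [typ, mul_comm]

section

-- `r + 1` is the degree of the transformation, `r + 1 + n` that of the fields to be reached; `C`
-- supplements the range of `ℓ`.
variable (hC : ∀ μ ∈ P (typ n) (r + 1 + n), ∃ p ∈ P (typ n) (r + 1), ∃ c ∈ C,
  μ = gradDot (leadVF n d) p + c)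
include hC

local notation "𝓢" => homologicalRange (typ n) (leadVF n d) (r + 1) C

/-- The part `ℓ(p) D₀` is the bracket with `p D₀`, whose extra term `-n p F_n` is cancelled by the
time change `n p`. -/
theorem mul_D0_mem_homologicalRange {μ : MvPolynomial (Fin 2) ℝ}
    (hμ : μ ∈ P (typ n) (r + 1 + n)) : (fun i => μ * D0 (typ n) i) ∈ 𝓢 := by
  obtain ⟨p, hp, c, hc, rfl⟩ := hC μ hμ
  refine ⟨fun j => p * D0 (typ n) j, mem_Q.mpr (mul_D0_mem hp),
    MvPolynomial.C (n : ℝ) * p, MvPolynomial.IsWeightedHomogeneous.C_mul hp _, c, hc, fun i => ?_⟩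
  rw [lieBracket_mul_D0 (leadVF_mem n d), map_natCast]
  ring

omit hC in
theorem mul_leadVF_mem_homologicalRange {ν : MvPolynomial (Fin 2) ℝ}
    (hν : ν ∈ P (typ n) (r + 1)) : (fun i => ν * leadVF n d i) ∈ 𝓢 :=
  ⟨0, zero_mem _, ν, hν, 0, zero_mem _, fun i => by simp [lieBracket, gradDot_apply]⟩

omit hC in
theorem lieBracket_mem_homologicalRange {u : MvPolynomial (Fin 2) ℝ}
    (hu : u ∈ P (typ n) (r + 1 + (n + 1))) : lieBracket (leadVF n d) ![0, u] ∈ 𝓢 := by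
  refine ⟨![0, u], mem_Q.mpr fun i => ?_, 0, zero_mem _, 0, zero_mem _, fun i => by simp⟩
  fin_cases i
  · exact zero_mem _
  · simpa [typ] using hu

/-- This field is `q F_n - d x^n q D₀`, a multiple of the Hamiltonian part `H` of `F_n`. -/
theorem mul_hamiltonian_mem_homologicalRange {q : MvPolynomial (Fin 2) ℝ}
    (hq : q ∈ P (typ n) (r + 1)) :
    ![q * MvPolynomial.X 1, ((n : MvPolynomial (Fin 2) ℝ) + 1) *
      (q * MvPolynomial.X 0 ^ (2 * n + 1))] ∈ 𝓢 := by
  have h1 : MvPolynomial.C d * (q * (MvPolynomial.X 0 ^ n * MvPolynomial.X 1 ^ 0)) ∈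
      P (typ n) (r + 1 + n) :=
    MvPolynomial.IsWeightedHomogeneous.C_mul
      (MvPolynomial.IsWeightedHomogeneous.mul hq (monomial_mem_P (by simp))) d
  have h2 := sub_mem (mul_leadVF_mem_homologicalRange (d := d) (C := C) hq)
    (mul_D0_mem_homologicalRange hC h1)
  convert h2 using 1
  funext i
  fin_cases i <;> simp [leadVF, D0, typ] <;> ring

/-- In `x^a y^(b+1) D₀ - x^(a+1) y^b H` the first components cancel. The outcome trades `y²` for
`x^(2n+2)` in second components. -/
theorem sub_mem_homologicalRange {a b : ℕ} (h : a + (n + 1) * (b + 2) = r + 2 * n + 2) :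
    ![0, MvPolynomial.X 0 ^ a * MvPolynomial.X 1 ^ (b + 2) -
      MvPolynomial.X 0 ^ (a + 2 * n + 2) * MvPolynomial.X 1 ^ b] ∈ 𝓢 := by
  have h1 := mul_D0_mem_homologicalRange hC
    (monomial_mem_P (n := n) (a := a) (b := b + 1) (by linarith))
  have h2 := mul_hamiltonian_mem_homologicalRange hC
    (monomial_mem_P (n := n) (a := a + 1) (b := b) (by linarith))
  have h3 := Submodule.smul_mem _ ((n : ℝ) + 1)⁻¹ (sub_mem h1 h2)
  have hn : (MvPolynomial.C ((n : ℝ) + 1)⁻¹ : MvPolynomial (Fin 2) ℝ) * (n + 1) = 1 := by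
    rw [← map_natCast MvPolynomial.C, ← map_one MvPolynomial.C, ← map_add, ← map_mul,
      inv_mul_cancel₀ (by positivity)]
  convert h3 using 1
  funext i
  rw [Pi.smul_apply, Pi.sub_apply, MvPolynomial.smul_eq_C_mul]
  fin_cases i
  · simp [D0, typ]; right; ring
  · simp [D0, typ, -map_add]
    linear_combination (-(MvPolynomial.X 0 ^ a * MvPolynomial.X 1 ^ (b + 2) -
      MvPolynomial.X 0 ^ (a + 2 * n + 2) * MvPolynomial.X 1 ^ b)) * hn

/-- Bracket with `(0, x^(r+n+2))`; adding `x^(r+n+1) D₀` kills the first component. -/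
theorem combination_x_mem_homologicalRange :
    ![0, (MvPolynomial.C ((r : ℝ) + 2 * n + 3) *
        (MvPolynomial.X 0 ^ (r + n + 1) * MvPolynomial.X 1) +
      MvPolynomial.C (d * (r + 1)) * MvPolynomial.X 0 ^ (r + 2 * n + 2))] ∈ 𝓢 := by
  have h1 := lieBracket_mem_homologicalRange (d := d) (C := C)
    (monomial_mem_P (n := n) (a := r + 1 + (n + 1)) (b := 0) (k := r + 1 + (n + 1)) (by simp))
  have h2 := mul_D0_mem_homologicalRange hC
    (monomial_mem_P (n := n) (a := r + 1 + n) (b := 0) (by simp))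
  convert add_mem h1 h2 using 1
  funext i
  fin_cases i <;>
    simp [lieBracket, gradDot_apply, leadVF, D0, typ, Derivation.leibniz_pow, Derivation.leibniz,
      MvPolynomial.pderiv_X, map_ofNat MvPolynomial.C] <;> ring

/-- Bracket with `(0, x^(r+1) y)`, corrected by `x^r y D₀`; the remaining `(r+n+2) x^r y²` is then
traded for a power of `x`. -/
theorem combination_y_mem_homologicalRange :
    ![0, (MvPolynomial.C ((r : ℝ) + 2 * n + 3) * MvPolynomial.X 0 ^ (r + 2 * n + 2) +
      MvPolynomial.C (d * (r + 1)) *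
        (MvPolynomial.X 0 ^ (r + n + 1) * MvPolynomial.X 1))] ∈ 𝓢 := by
  have h1 := lieBracket_mem_homologicalRange (d := d) (C := C)
    (monomial_mem_P (n := n) (a := r + 1) (b := 1) (k := r + 1 + (n + 1)) (by simp))
  have h2 := mul_D0_mem_homologicalRange hC
    (monomial_mem_P (n := n) (a := r) (b := 1) (by ring))
  have h3 := Submodule.smul_mem _ ((r : ℝ) + n + 2)
    (sub_mem_homologicalRange hC (a := r) (b := 0) (by ring))
  convert sub_mem (add_mem h1 h2) h3 using 1
  funext i
  fin_cases i <;>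
    simp [lieBracket, gradDot_apply, leadVF, D0, typ, Derivation.leibniz_pow, Derivation.leibniz,
      MvPolynomial.pderiv_X, MvPolynomial.smul_eq_C_mul,
      map_ofNat MvPolynomial.C] <;> ring

variable (hd : |d| ≠ 1 + 2 * ((n : ℝ) + 1) / ((r + 1 : ℕ) : ℝ))
include hd

/-- The two combinations form a symmetric system with diagonal `m` and off-diagonal `c`. It is
singular only if `|d| (r+1) = r+2n+3`, the value excluded by `hd`; Cramer's rule does the rest. -/
theorem x_pow_and_y_mem_homologicalRange :
    ![0, MvPolynomial.X 0 ^ (r + 2 * n + 2)] ∈ 𝓢 ∧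
      ![0, MvPolynomial.X 0 ^ (r + n + 1) * MvPolynomial.X 1] ∈ 𝓢 := by
  have hdet : ((r : ℝ) + 2 * n + 3) ^ 2 - (d * (r + 1)) ^ 2 ≠ 0 := by
    intro h
    have hr : (0 : ℝ) < r + 1 := by positivity
    apply hd
    have h1 : |d * (r + 1)| = |(r : ℝ) + 2 * n + 3| := (sq_eq_sq_iff_abs_eq_abs _ _).mp (by linarith)
    rw [abs_mul, abs_of_pos hr, abs_of_nonneg (by positivity : (0 : ℝ) ≤ r + 2 * n + 3)] at h1
    push_cast
    field_simp
    linarith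
  have h1 := combination_x_mem_homologicalRange hC
  have h2 := combination_y_mem_homologicalRange hC
  set m : ℝ := (r : ℝ) + 2 * n + 3
  set c : ℝ := d * (r + 1)
  have hinv : (MvPolynomial.C (m ^ 2 - c ^ 2)⁻¹ : MvPolynomial (Fin 2) ℝ) *
      (MvPolynomial.C m ^ 2 - MvPolynomial.C c ^ 2) = 1 := by
    rw [← map_pow, ← map_pow, ← map_sub, ← map_mul, inv_mul_cancel₀ hdet, map_one]
  constructor
  · convert Submodule.smul_mem _ (m ^ 2 - c ^ 2)⁻¹
      (sub_mem (Submodule.smul_mem _ m h2) (Submodule.smul_mem _ c h1)) using 1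
    funext i
    fin_cases i
    · simp
    · simp [MvPolynomial.smul_eq_C_mul, -map_inv₀, -map_sub, -map_pow]
      linear_combination (-MvPolynomial.X 0 ^ (r + 2 * n + 2)) * hinv
  · convert Submodule.smul_mem _ (m ^ 2 - c ^ 2)⁻¹
      (sub_mem (Submodule.smul_mem _ m h1) (Submodule.smul_mem _ c h2)) using 1
    funext i
    fin_cases i
    · simp
    · simp [MvPolynomial.smul_eq_C_mul, -map_inv₀, -map_sub, -map_pow]
      linear_combination (-(MvPolynomial.X 0 ^ (r + n + 1) * MvPolynomial.X 1)) * hinv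

theorem monomial_snd_mem_homologicalRange (b : ℕ) : ∀ a, a + (n + 1) * b = r + 2 * n + 2 →
    ![0, MvPolynomial.X 0 ^ a * MvPolynomial.X 1 ^ b] ∈ 𝓢 := by
  induction b using Nat.strong_induction_on with
  | _ b ih =>
    intro a h
    match b, ih, h with
    | 0, _, h =>
      obtain rfl : a = r + 2 * n + 2 := by simpa using h
      simpa using (x_pow_and_y_mem_homologicalRange hC hd).1
    | 1, _, h =>
      obtain rfl : a = r + n + 1 := by omega
      simpa using (x_pow_and_y_mem_homologicalRange hC hd).2
    | b + 2, ih, h =>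
      convert add_mem (sub_mem_homologicalRange hC h)
        (ih b (by omega) (a + 2 * n + 2) (by rw [← h]; ring)) using 1
      funext i
      fin_cases i <;> simp

theorem snd_mem_homologicalRange {f : MvPolynomial (Fin 2) ℝ}
    (hf : f ∈ P (typ n) (r + 2 * n + 2)) : ![0, f] ∈ 𝓢 :=
by
  have h := P_le_of_monomial_mem (S := Submodule.comap
    (LinearMap.single ℝ (fun _ => MvPolynomial (Fin 2) ℝ) 1) 𝓢) (fun a b h => by
      have e := monomial_snd_mem_homologicalRange hC hd b a h
      rwa [← single_one_eq] at e) hf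
  rw [← single_one_eq]
  exact h

/-- A monomial divisible by `x` is the first component of a multiple of `D₀`, a pure power of `y`
that of a multiple of `H`; the second components are already reached. -/
theorem monomial_fst_mem_homologicalRange {a b : ℕ} (h : a + (n + 1) * b = r + n + 2) :
    ![MvPolynomial.X 0 ^ a * MvPolynomial.X 1 ^ b, 0] ∈ 𝓢 := by
  match a, b, h with
  | a + 1, b, h =>
    have h1 := mul_D0_mem_homologicalRange hC
      (monomial_mem_P (n := n) (a := a) (b := b) (by linarith))
    have h2 := snd_mem_homologicalRange hC hd (MvPolynomial.IsWeightedHomogeneous.C_mul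
      (monomial_mem_P (n := n) (a := a) (b := b + 1) (by linarith)) ((n : ℝ) + 1))
    convert sub_mem h1 h2 using 1
    funext i
    rw [Pi.sub_apply]
    fin_cases i <;> simp [D0, typ] <;> ring
  | 0, b + 1, h =>
    have h1 := mul_hamiltonian_mem_homologicalRange hC
      (monomial_mem_P (n := n) (a := 0) (b := b) (by linarith))
    have h2 := snd_mem_homologicalRange hC hd (MvPolynomial.IsWeightedHomogeneous.C_mul
      (monomial_mem_P (n := n) (a := 2 * n + 1) (b := b) (by linarith)) ((n : ℝ) + 1))
    convert sub_mem h1 h2 using 1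
    funext i
    rw [Pi.sub_apply]
    fin_cases i <;> simp <;> ring

/-- Solvability of the homological equation. -/
theorem Q_le_homologicalRange : Q (typ n) (r + 1 + n) ≤ 𝓢 := by
  intro W hW
  have h0 : ![W 0, 0] ∈ 𝓢 := by
    have h := P_le_of_monomial_mem (S := Submodule.comap
      (LinearMap.single ℝ (fun _ => MvPolynomial (Fin 2) ℝ) 0) 𝓢) (fun a b h => by
        have e := monomial_fst_mem_homologicalRange hC hd (by simpa [typ, add_assoc, add_comm 1] using h)
        rwa [← single_zero_eq] at e) (mem_Q.mp hW 0)
    rw [← single_zero_eq]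
    exact h
  have h1 : ![0, W 1] ∈ 𝓢 := by
    have h := mem_Q.mp hW 1
    have e : r + 1 + n + typ n 1 = r + 2 * n + 2 := by simp [typ]; ring
    rw [e] at h
    exact snd_mem_homologicalRange hC hd h
  convert add_mem h0 h1 using 1
  funext i
  fin_cases i <;> simp

end

end Homological

/-! ### The conjugation defect and partial normal forms. -/

theorem fieldDeriv_coe (V : PolyVF) (p : MvPolynomial (Fin 2) ℝ) :
    fieldDeriv (fun i => (V i : MvPowerSeries (Fin 2) ℝ)) p = (gradDot V p : MvPolynomial _ ℝ) := by
  rw [fieldDeriv_apply, gradDot_apply, Fin.sum_univ_two, MvPolynomial.coe_add, MvPolynomial.coe_mul,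
    MvPolynomial.coe_mul, MvPowerSeries.pderiv_coe, MvPowerSeries.pderiv_coe]

theorem typ_ne_zero (n : ℕ) (i : Fin 2) : typ n i ≠ 0 := by
  fin_cases i <;> simp [typ]

theorem hasSubst_of_mem_weightIdeal {n : ℕ} {Φ : FormalVF}
    (hΦ : ∀ i, Φ i ∈ weightIdeal (typ n) (typ n i)) : MvPowerSeries.HasSubst Φ :=
  MvPowerSeries.hasSubst_of_constantCoeff_zero
    (constantCoeff_eq_zero_of_mem_weightIdeal (typ_ne_zero n) hΦ)

/-- The defect of the conjugation equation `DΦ · (ν F) = G ∘ Φ`. -/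
def residual (F : FormalVF) (Φ : FormalVF) (ν : MvPowerSeries (Fin 2) ℝ) (G : FormalVF) :
    FormalVF :=
  fun i => ν * fieldDeriv F (Φ i) - MvPowerSeries.subst Φ (G i)

/-- The field `L + R`, for `L` the leading field `leadVF n d`. -/
def leadAdd (n : ℕ) (d : ℝ) (R : FormalVF) : FormalVF :=
  fun i => (leadVF n d i : MvPowerSeries (Fin 2) ℝ) + R i

/-- The transformation `(Φ, ν)` takes `F` to `leadVF n d + R` up to terms of degree `> r + n`. -/
structure IsPartialNormalForm (n : ℕ) (d : ℝ) (F : FormalVF) (r : ℕ) (Φ : FormalVF)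
    (ν : MvPowerSeries (Fin 2) ℝ) (R : FormalVF) : Prop where
  map_sub_X : ∀ i, Φ i - MvPowerSeries.X i ∈ weightIdeal (typ n) (typ n i + 1)
  time_sub_one : ν - 1 ∈ weightIdeal (typ n) 1
  remainder : ∀ i, R i ∈ weightIdeal (typ n) (n + 1 + typ n i)
  residual_mem : ∀ i, residual F Φ ν (leadAdd n d R) i ∈
    weightIdeal (typ n) (r + 1 + n + typ n i)

/-! ### One normalisation step. -/

section Step

variable {n : ℕ} {d : ℝ} {F : FormalVF}

theorem leadVF_coe_mem (n : ℕ) (d : ℝ) (i : Fin 2) :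
    (leadVF n d i : MvPowerSeries (Fin 2) ℝ) ∈ weightIdeal (typ n) (n + typ n i) :=
  coe_mem_weightIdeal (mem_Q.mp (leadVF_mem n d) i)

theorem IsPartialNormalForm.initial
    (hF : ∀ i, F i - leadVF n d i ∈ weightIdeal (typ n) (n + 1 + typ n i)) :
    IsPartialNormalForm n d F 0 MvPowerSeries.X 1 0 where
  map_sub_X i := by simp
  time_sub_one := by simp
  remainder i := zero_mem _
  residual_mem i := by
    have h := hF i
    rw [residual, fieldDeriv_X, one_mul, MvPowerSeries.subst_self, id, leadAdd, Pi.zero_apply,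
      add_zero]
    exact weightIdeal_anti (by omega) h

/-- Corrections are added to `Φ` and `ν`, not composed with them, so the new defect is the old one
plus the homological expression, up to higher weight. -/
theorem IsPartialNormalForm.exists_step
    (hF : ∀ i, F i - leadVF n d i ∈ weightIdeal (typ n) (n + 1 + typ n i))
    {r : ℕ} {C : Submodule ℝ (MvPolynomial (Fin 2) ℝ)} (hCP : C ≤ P (typ n) (r + 1 + n))
    (hsolve : Q (typ n) (r + 1 + n) ≤ homologicalRange (typ n) (leadVF n d) (r + 1) C)
    {Φ : FormalVF} {ν : MvPowerSeries (Fin 2) ℝ} {R : FormalVF}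
    (h : IsPartialNormalForm n d F r Φ ν R) :
    ∃ (Φ' : FormalVF) (ν' : MvPowerSeries (Fin 2) ℝ), ∃ μ ∈ C,
      (∀ i, Φ' i - Φ i ∈ weightIdeal (typ n) (typ n i + (r + 1))) ∧
      ν' - ν ∈ weightIdeal (typ n) (r + 1) ∧
      IsPartialNormalForm n d F (r + 1) Φ' ν'
        (fun i => R i + (μ * D0 (typ n) i : MvPolynomial (Fin 2) ℝ)) := by
  choose p hp hres using fun i => exists_leading_part (typ_ne_zero n) (h.residual_mem i)
  -- The equation is solved for minus the leading defect. `μ₀` changes sign because `G ∘ Φ` enters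
  -- the defect negatively.
  obtain ⟨U, hU, ν₀, hν₀, μ₀, hμ₀, hsol⟩ := hsolve (neg_mem (mem_Q.mpr hp))
  have hμ : -μ₀ ∈ C := neg_mem hμ₀
  generalize hμdef : -μ₀ = μ at hμ
  have hU' : ∀ i, (U i : MvPowerSeries (Fin 2) ℝ) ∈ weightIdeal (typ n) (r + 1 + typ n i) :=
    fun i => coe_mem_weightIdeal (mem_Q.mp hU i)
  have hν' : (ν₀ : MvPowerSeries (Fin 2) ℝ) ∈ weightIdeal (typ n) (r + 1) :=
    coe_mem_weightIdeal hν₀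
  have hμ' : ∀ i, ((μ * D0 (typ n) i : MvPolynomial (Fin 2) ℝ) : MvPowerSeries (Fin 2) ℝ) ∈
      weightIdeal (typ n) (r + 1 + n + typ n i) :=
    fun i => coe_mem_weightIdeal (mul_D0_mem (hCP hμ) i)
  have hmap : ∀ i, Φ i + (U i : MvPowerSeries (Fin 2) ℝ) - MvPowerSeries.X i ∈ weightIdeal (typ n) (typ n i + 1) := by
    intro i
    rw [add_sub_right_comm]
    exact add_mem (h.map_sub_X i) (weightIdeal_anti (by omega) (hU' i))
  have htime : ν + (ν₀ : MvPowerSeries (Fin 2) ℝ) - 1 ∈ weightIdeal (typ n) 1 := by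
    rw [add_sub_right_comm]
    exact add_mem h.time_sub_one (weightIdeal_anti (by omega) hν')
  have hΦ : ∀ i, Φ i ∈ weightIdeal (typ n) (typ n i) := fun i =>
    mem_weightIdeal_of_sub (Nat.le_succ _) (h.map_sub_X i) (X_mem_weightIdeal _ i)
  have hΨ : ∀ i, Φ i + (U i : MvPowerSeries (Fin 2) ℝ) ∈ weightIdeal (typ n) (typ n i) := fun i =>
    mem_weightIdeal_of_sub (Nat.le_succ _) (hmap i) (X_mem_weightIdeal _ i)
  have hsΦ := hasSubst_of_mem_weightIdeal hΦ
  have hsΨ : MvPowerSeries.HasSubst fun i => Φ i + (U i : MvPowerSeries (Fin 2) ℝ) :=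
    hasSubst_of_mem_weightIdeal hΨ
  have hdiff : ∀ i, Φ i + (U i : MvPowerSeries (Fin 2) ℝ) - Φ i ∈ weightIdeal (typ n) (typ n i + (r + 1)) := fun i => by
    rw [add_sub_cancel_left]
    exact weightIdeal_anti (by omega) (hU' i)
  have hFm : ∀ i, F i ∈ weightIdeal (typ n) (n + typ n i) := fun i =>
    mem_weightIdeal_of_sub (by omega) (hF i) (leadVF_coe_mem n d i)
  refine ⟨fun i => Φ i + (U i : MvPowerSeries (Fin 2) ℝ), ν + (ν₀ : MvPowerSeries (Fin 2) ℝ), μ, hμ, hdiff, ?_, hmap, htime, fun i =>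
    add_mem (h.remainder i) (weightIdeal_anti (by omega) (hμ' i)), fun i => ?_⟩
  · rwa [add_sub_cancel_left]
  -- `e1` to `e7` are the errors in replacing each increment of the defect by its leading part; all
  -- have weight one more than the part cancelled by `hs`.
  have e1 : (ν₀ : MvPowerSeries (Fin 2) ℝ) * (fieldDeriv F (Φ i) - leadVF n d i) ∈
      weightIdeal (typ n) (r + 1 + 1 + n + typ n i) := by
    have e : fieldDeriv F (Φ i) - leadVF n d i =
        fieldDeriv F (Φ i - MvPowerSeries.X i) + (F i - leadVF n d i) := by
      rw [map_sub, fieldDeriv_X]; ring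
    rw [e]
    refine weightIdeal_anti ?_ (mul_mem_weightIdeal hν' (N := n + 1 + typ n i) (add_mem
      (weightIdeal_anti (by omega) (fieldDeriv_mem_weightIdeal (h.map_sub_X i) hFm)) (hF i)))
    omega
  have e2 : (ν + (ν₀ : MvPowerSeries (Fin 2) ℝ) - 1) * fieldDeriv F (U i) ∈
      weightIdeal (typ n) (r + 1 + 1 + n + typ n i) :=
    weightIdeal_anti (by omega)
      (mul_mem_weightIdeal htime (fieldDeriv_mem_weightIdeal (hU' i) hFm))
  have e3 : fieldDeriv F (U i) - fieldDeriv (fun j => (leadVF n d j : MvPowerSeries (Fin 2) ℝ))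
      (U i) ∈ weightIdeal (typ n) (r + 1 + 1 + n + typ n i) := by
    rw [← fieldDeriv_sub_left]
    exact weightIdeal_anti (by omega) (fieldDeriv_mem_weightIdeal (hU' i) hF)
  have e4 := weightIdeal_anti (M := r + 1 + 1 + n + typ n i) (by omega)
    (aeval_sub_aeval_sub_fieldDeriv_mem (by omega) h.map_sub_X hdiff
      (mem_Q.mp (leadVF_mem n d) i))
  have e5 := weightIdeal_anti (M := r + 1 + 1 + n + typ n i) (by omega)
    (subst_sub_subst_mem_weightIdeal hsΦ hsΨ hΦ hΨ hdiff (h.remainder i))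
  have e6 := weightIdeal_anti (M := r + 1 + 1 + n + typ n i) (by omega)
    (subst_sub_subst_mem_weightIdeal MvPowerSeries.HasSubst.X hsΨ (X_mem_weightIdeal _) hΨ hmap
      (hμ' i))
  have e7 := weightIdeal_anti (M := r + 1 + 1 + n + typ n i) (by omega) (hres i)
  have hmain := sub_mem (sub_mem (sub_mem (add_mem (add_mem (add_mem e7 e1) e2) e3) e4) e5) e6
  have hs : -(p i : MvPowerSeries (Fin 2) ℝ) =
      fieldDeriv (fun j => (leadVF n d j : MvPowerSeries (Fin 2) ℝ)) (U i) -
      fieldDeriv (fun j => (U j : MvPowerSeries (Fin 2) ℝ)) (leadVF n d i) +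
      ν₀ * leadVF n d i - (μ * D0 (typ n) i : MvPolynomial (Fin 2) ℝ) := by
    have := congrArg (MvPolynomial.coeToMvPowerSeries.ringHom (R := ℝ)) (hsol i)
    rw [fieldDeriv_coe, fieldDeriv_coe]
    rw [← hμdef]
    simp only [← MvPolynomial.coeToMvPowerSeries.ringHom_apply, map_mul, map_neg, map_add,
      map_sub, Pi.neg_apply, lieBracket] at this ⊢
    rw [this]
    ring
  convert hmain using 1
  simp only [residual, leadAdd, add_sub_cancel_left]
  rw [MvPowerSeries.subst_add hsΨ, MvPowerSeries.subst_add hsΨ, MvPowerSeries.subst_add hsΦ,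
    MvPowerSeries.subst_coe (leadVF n d i), MvPowerSeries.subst_coe (leadVF n d i),
    MvPowerSeries.subst_self, id, map_add]
  linear_combination -hs

end Step

/-! ### Passage to the limit. -/

section Limit

variable {n : ℕ} {d : ℝ} {F : FormalVF}

/-- The defect is continuous in `(Φ, ν, R)`: modulo weight `r` the limit has the defect of stage
`r`, which vanishes there. -/
theorem residual_eq_zero_of_limit
    (hF : ∀ i, F i ∈ weightIdeal (typ n) (n + typ n i))
    {Φ : ℕ → FormalVF} {ν : ℕ → MvPowerSeries (Fin 2) ℝ} {R : ℕ → FormalVF}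
    {Ψ : FormalVF} {τ : MvPowerSeries (Fin 2) ℝ} {S : FormalVF}
    (h : ∀ r, IsPartialNormalForm n d F r (Φ r) (ν r) (R r))
    (hΨ : ∀ i r, Ψ i - Φ r i ∈ weightIdeal (typ n) (r + (typ n i + 1)))
    (hτ : ∀ r, τ - ν r ∈ weightIdeal (typ n) (r + 1))
    (hS : ∀ i r, S i - R r i ∈ weightIdeal (typ n) (r + (n + 1 + typ n i))) (i : Fin 2) :
    residual F Ψ τ (leadAdd n d S) i = 0 := by
  refine eq_zero_of_forall_mem_weightIdeal (w := typ n) fun r => ?_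
  have hΦr : ∀ i, Φ r i ∈ weightIdeal (typ n) (typ n i) := fun i =>
    mem_weightIdeal_of_sub (Nat.le_succ _) ((h r).map_sub_X i) (X_mem_weightIdeal _ i)
  have hΨr : ∀ i, Ψ i ∈ weightIdeal (typ n) (typ n i) := fun i =>
    mem_weightIdeal_of_sub (by omega) (hΨ i r) (hΦr i)
  have hsΦ := hasSubst_of_mem_weightIdeal hΦr
  have hsΨ := hasSubst_of_mem_weightIdeal hΨr
  have e1 := Ideal.mul_mem_right (fieldDeriv F (Ψ i)) _ (weightIdeal_anti (Nat.le_succ r) (hτ r))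
  have e2 := Ideal.mul_mem_left _ (ν r)
    (weightIdeal_anti (M := r) (by omega) (fieldDeriv_mem_weightIdeal (hΨ i r) hF))
  have e3 := weightIdeal_anti (M := r) (by omega) (subst_sub_subst_mem_weightIdeal hsΦ hsΨ hΦr hΨr
    (fun i => weightIdeal_anti (show typ n i + r ≤ _ by omega) (hΨ i r))
    (mem_weightIdeal_zero (leadAdd n d S i)))
  have e4 := weightIdeal_anti (M := r) (by omega) (subst_mem_weightIdeal hsΦ hΦr (hS i r))
  have e5 := weightIdeal_anti (M := r) (by omega) ((h r).residual_mem i)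
  convert sub_mem (sub_mem (add_mem (add_mem e5 e1) e2) e3) e4 using 1
  simp only [residual, leadAdd]
  rw [MvPowerSeries.subst_add hsΨ, MvPowerSeries.subst_add hsΦ, MvPowerSeries.subst_add hsΦ,
    MvPowerSeries.subst_sub hsΦ, map_sub]
  ring

/-- The linear part is unitriangular: `y` may occur in the first component, but `x` is too light to
occur in the correction of the second. -/
theorem det_linear_part {Φ : FormalVF}
    (h : ∀ i, Φ i - MvPowerSeries.X i ∈ weightIdeal (typ n) (typ n i + 1)) :
    (Matrix.of fun i j => MvPowerSeries.constantCoeff (MvPowerSeries.pderiv ℝ j (Φ i))).det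
      = 1 := by
  have hc : ∀ i j, typ n j < typ n i + 1 →
      MvPowerSeries.constantCoeff (MvPowerSeries.pderiv ℝ j (Φ i)) = if j = i then 1 else 0 := by
    intro i j hij
    rw [← MvPowerSeries.coeff_zero_eq_constantCoeff_apply, MvPowerSeries.coeff_pderiv]
    have h1 := mem_weightIdeal.mp (h i) (Finsupp.single j 1) (by
      rwa [Finsupp.weight_single, one_smul])
    rw [map_sub, sub_eq_zero] at h1
    rw [zero_add, h1, MvPowerSeries.coeff_X]
    simp [Finsupp.single_left_inj]
  rw [Matrix.det_fin_two]
  simp only [Matrix.of_apply]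
  rw [hc 0 0 (by simp), hc 1 1 (by simp), hc 1 0 (by simp [typ])]
  simp

theorem sub_leadVF_mem {Fj : Set.Ici n → PolyVF} (hFj : ∀ j : Set.Ici n, Fj j ∈ Q (typ n) (j : ℕ))
    (hFn : Fj ⟨n, Set.self_mem_Ici⟩ = leadVF n d) (hF : IsFormalSum Fj F) (i : Fin 2) :
    F i - leadVF n d i ∈ weightIdeal (typ n) (n + 1 + typ n i) := by
  rw [mem_weightIdeal]
  intro m hm
  have h1 := MvPowerSeries.WithPiTopology.hasSum_iff_hasSum_coeff.mp (hF i) m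
  have h2 := hasSum_single (f := fun j => MvPowerSeries.coeff m
    (Fj j i : MvPowerSeries (Fin 2) ℝ)) ⟨n, Set.self_mem_Ici⟩ fun j hj => by
      have hj' : n + 1 ≤ j := Nat.succ_le_of_lt (lt_of_le_of_ne j.2 fun e => hj (Subtype.ext e.symm))
      exact mem_weightIdeal.mp (coe_mem_weightIdeal (mem_Q.mp (hFj j) i)) m (by omega)
  rw [map_sub, h1.unique h2, hFn, sub_self]

/-- The sum of quasi-homogeneous multiples of `D₀` agrees with the limit of its partial sums. -/
theorem isFormalSum_of_limit {μ : (k : Set.Ioi n) → P (typ n) (k : ℕ)}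
    {μ' : ℕ → MvPolynomial (Fin 2) ℝ} (hμ : ∀ (k : Set.Ioi n) r, (k : ℕ) = r + 1 + n →
      (μ k : MvPolynomial (Fin 2) ℝ) = μ' r) {R : ℕ → FormalVF} {S : FormalVF} (hR0 : R 0 = 0)
    (hR : ∀ r i, R (r + 1) i = R r i + (μ' r * D0 (typ n) i : MvPolynomial (Fin 2) ℝ))
    (hS : ∀ i r, S i - R r i ∈ weightIdeal (typ n) (r + (n + 1 + typ n i))) :
    IsFormalSum (fun k i => (μ k : MvPolynomial (Fin 2) ℝ) * D0 (typ n) i) S := by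
  let e : ℕ ≃ Set.Ioi n :=
    { toFun := fun r => ⟨r + 1 + n, Set.mem_Ioi.mpr (by omega)⟩
      invFun := fun k => (k : ℕ) - n - 1
      left_inv := fun r => by simp
      right_inv := fun k => Subtype.ext (by have := Set.mem_Ioi.mp k.2; simp; omega) }
  have he : ∀ r, (μ (e r) : MvPolynomial (Fin 2) ℝ) = μ' r := fun r => hμ _ r rfl
  have hsum : ∀ r i, R r i = ∑ s ∈ Finset.range r,
      ((μ' s * D0 (typ n) i : MvPolynomial (Fin 2) ℝ) : MvPowerSeries (Fin 2) ℝ) := by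
    intro r i
    induction r with
    | zero => simp [hR0]
    | succ r ih => rw [hR, ih, Finset.sum_range_succ]
  intro i
  rw [MvPowerSeries.WithPiTopology.hasSum_iff_hasSum_coeff]
  intro m
  rw [← e.hasSum_iff]
  -- Terms with index at least the weight of `m` do not reach `m`, so this partial sum already has
  -- the final coefficient.
  have h0 := mem_weightIdeal.mp (hS i (Finsupp.weight (typ n) m)) m (by omega)
  rw [map_sub, sub_eq_zero, hsum, map_sum] at h0
  rw [h0]
  have h1 := hasSum_sum_of_ne_finset_zero (L := SummationFilter.unconditional ℕ) (f := fun s => MvPowerSeries.coeff m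
    ((μ' s * D0 (typ n) i : MvPolynomial (Fin 2) ℝ) : MvPowerSeries (Fin 2) ℝ))
    (s := Finset.range (Finsupp.weight (typ n) m)) fun s hs => by
      have hP : μ' s ∈ P (typ n) (s + 1 + n) := by
        rw [← he s]
        exact (μ (e s)).2
      refine mem_weightIdeal.mp (coe_mem_weightIdeal (mul_D0_mem hP i)) m ?_
      rw [Finset.mem_range] at hs
      omega
  simp only [Function.comp_def, he]
  exact h1

end Limit

/-! ### Iteration of the step and the main theorem. -/

theorem exists_seq_of_step {α : Type*} {inv : ℕ → α → Prop} {rel : ℕ → α → α → Prop} {a : α}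
    (h0 : inv 0 a) (hstep : ∀ r x, inv r x → ∃ y, inv (r + 1) y ∧ rel r x y) :
    ∃ f : ℕ → α, f 0 = a ∧ ∀ r, inv r (f r) ∧ rel r (f r) (f (r + 1)) := by
  choose next hnext using hstep
  let g : (r : ℕ) → {x // inv r x} := fun r =>
    Nat.rec ⟨a, h0⟩ (fun r x => ⟨next r x x.2, (hnext r x x.2).1⟩) r
  exact ⟨fun r => (g r).1, rfl, fun r => ⟨(g r).2, (hnext r _ (g r).2).2⟩⟩

theorem exists_add_of_isCompl {n : ℕ} {d : ℝ} {r : ℕ} {hk : n ≤ r + 1 + n}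
    {C : Submodule ℝ (P (typ n) (r + 1 + n))}
    (hC : IsCompl (LinearMap.range (ell (leadVF_mem n d) hk)) C)
    (μ : MvPolynomial (Fin 2) ℝ) (hμ : μ ∈ P (typ n) (r + 1 + n)) :
    ∃ p ∈ P (typ n) (r + 1), ∃ c ∈ C.map (P (typ n) (r + 1 + n)).subtype,
      μ = gradDot (leadVF n d) p + c := by
  have h : (⟨μ, hμ⟩ : P (typ n) (r + 1 + n)) ∈ LinearMap.range (ell (leadVF_mem n d) hk) ⊔ C := by
    rw [hC.sup_eq_top]; trivial
  obtain ⟨_, ⟨p, rfl⟩, c, hc, h⟩ := Submodule.mem_sup.mp h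
  refine ⟨p, ?_, c, Submodule.mem_map_of_mem hc, (congrArg Subtype.val h).symm⟩
  -- The degrees `r + 1 + n - n` and `r + 1` are identified at the level of membership, avoiding a
  -- cast between subtypes.
  have h2 : ∀ q ∈ P (typ n) (r + 1 + n - n), q ∈ P (typ n) (r + 1) := by
    rw [Nat.add_sub_cancel]
    exact fun _ h => h
  exact h2 p p.2

end QuasiHom

end

theorem mainTheorem8 (n : ℕ) (hn : 1 ≤ n) (d : ℝ) (hd : d ≠ 0)
    (hdk : ∀ k : ℕ, 1 ≤ k → |d| ≠ 1 + 2 * ((n : ℝ) + 1) / (k : ℝ))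
    (Fj : Set.Ici n → QuasiHom.PolyVF)
    (hFj : ∀ j : Set.Ici n, Fj j ∈ QuasiHom.Q (QuasiHom.typ n) (j : ℕ))
    (hFn : Fj ⟨n, Set.self_mem_Ici⟩ = QuasiHom.leadVF n d)
    (F : QuasiHom.FormalVF) (hF : QuasiHom.IsFormalSum Fj F)
    (Cor : (k : Set.Ioi n) → Submodule ℝ (QuasiHom.P (QuasiHom.typ n) (k : ℕ)))
    (hCor : ∀ k : Set.Ioi n,
      IsCompl (LinearMap.range (QuasiHom.ell (QuasiHom.leadVF_mem n d) (le_of_lt k.2))) (Cor k)) :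
    ∃ (μ : (k : Set.Ioi n) → QuasiHom.P (QuasiHom.typ n) (k : ℕ)) (R : QuasiHom.FormalVF),
      (∀ k, μ k ∈ Cor k) ∧
      QuasiHom.IsFormalSum
        (fun k i => (μ k : MvPolynomial (Fin 2) ℝ) * QuasiHom.D0 (QuasiHom.typ n) i) R ∧
      QuasiHom.OrbitallyEquivalent F
        (fun i => (QuasiHom.leadVF n d i : MvPowerSeries (Fin 2) ℝ) + R i) := by
  have hFlead := QuasiHom.sub_leadVF_mem hFj hFn hF
  have hFm : ∀ i, F i ∈ QuasiHom.weightIdeal (QuasiHom.typ n) (n + QuasiHom.typ n i) := fun i =>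
    QuasiHom.mem_weightIdeal_of_sub (by omega) (hFlead i) (QuasiHom.leadVF_coe_mem n d i)
  have hmem : ∀ r, r + 1 + n ∈ Set.Ioi n := fun r => Set.mem_Ioi.mpr (by omega)
  let C : ℕ → Submodule ℝ (MvPolynomial (Fin 2) ℝ) := fun r =>
    (Cor ⟨r + 1 + n, hmem r⟩).map (QuasiHom.P (QuasiHom.typ n) (r + 1 + n)).subtype
  obtain ⟨f, hf0, hf⟩ := QuasiHom.exists_seq_of_step
    (a := ((MvPowerSeries.X, 1, 0) :
      QuasiHom.FormalVF × MvPowerSeries (Fin 2) ℝ × QuasiHom.FormalVF))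
    (inv := fun r s => QuasiHom.IsPartialNormalForm n d F r s.1 s.2.1 s.2.2)
    (rel := fun r s s' =>
      (∀ i, s'.1 i - s.1 i ∈ QuasiHom.weightIdeal (QuasiHom.typ n)
        (QuasiHom.typ n i + (r + 1))) ∧
      s'.2.1 - s.2.1 ∈ QuasiHom.weightIdeal (QuasiHom.typ n) (r + 1) ∧
      ∃ μ ∈ C r, ∀ i, s'.2.2 i = s.2.2 i +
        ((μ * QuasiHom.D0 (QuasiHom.typ n) i : MvPolynomial (Fin 2) ℝ) :
          MvPowerSeries (Fin 2) ℝ))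
    (QuasiHom.IsPartialNormalForm.initial hFlead) (fun r s hs => by
      obtain ⟨Φ', ν', μ, hμ, h1, h2, h3⟩ := hs.exists_step hFlead (C := C r)
        (Submodule.map_subtype_le _ _)
        (QuasiHom.Q_le_homologicalRange
          (QuasiHom.exists_add_of_isCompl (hCor ⟨r + 1 + n, hmem r⟩)) (hdk (r + 1) (by omega)))
      exact ⟨⟨Φ', ν', _⟩, h3, h1, h2, μ, hμ, fun _ => rfl⟩)
  choose hinv hΦ hν μ' hμ' hR using hf
  choose Φ hΦlim using fun i => QuasiHom.exists_limit_weightIdeal (w := QuasiHom.typ n)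
    (fun r => (f r).1 i) (QuasiHom.typ n i + 1)
    fun r => QuasiHom.weightIdeal_anti (by omega) (hΦ r i)
  obtain ⟨ν, hνlim⟩ := QuasiHom.exists_limit_weightIdeal (fun r => (f r).2.1) 1 hν
  -- Step `r` produces the coefficient of degree `k = r + 1 + n`; quantifying over `r` with this
  -- equation avoids transport along `k`.
  choose μ hμC hμ using show ∀ k : Set.Ioi n, ∃ m : QuasiHom.P (QuasiHom.typ n) (k : ℕ),
      m ∈ Cor k ∧ ∀ r, (k : ℕ) = r + 1 + n → (m : MvPolynomial (Fin 2) ℝ) = μ' r by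
    rintro ⟨k, hk⟩
    obtain ⟨r, rfl⟩ : ∃ r, k = r + 1 + n := ⟨k - n - 1, by have := Set.mem_Ioi.mp hk; omega⟩
    obtain ⟨m, hm, hm'⟩ := hμ' r
    refine ⟨m, hm, fun s hs => ?_⟩
    obtain rfl : r = s := by simpa using hs
    exact hm'
  choose R hRlim using fun i => QuasiHom.exists_limit_weightIdeal (w := QuasiHom.typ n)
    (fun r => (f r).2.2 i) (n + 1 + QuasiHom.typ n i) fun r => by
      simp only [hR, add_sub_cancel_left]
      exact QuasiHom.weightIdeal_anti (by omega) (QuasiHom.coe_mem_weightIdeal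
        (QuasiHom.mul_D0_mem (Submodule.map_subtype_le _ _ (hμ' r)) i))
  have hΦX : ∀ i, Φ i - MvPowerSeries.X i ∈
      QuasiHom.weightIdeal (QuasiHom.typ n) (QuasiHom.typ n i + 1) := fun i => by
    have := hΦlim i 0
    rwa [hf0, zero_add] at this
  refine ⟨μ, R, hμC, QuasiHom.isFormalSum_of_limit hμ (R := fun r => (f r).2.2) (by rw [hf0])
    (fun r i => by rw [hR]) hRlim, Φ, ν, ?_, ?_, ?_, fun i => ?_⟩
  · exact QuasiHom.constantCoeff_eq_zero_of_mem_weightIdeal (QuasiHom.typ_ne_zero n) fun i =>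
      QuasiHom.mem_weightIdeal_of_sub (Nat.le_succ _) (hΦX i) (QuasiHom.X_mem_weightIdeal _ i)
  · rw [QuasiHom.det_linear_part hΦX]
    exact one_ne_zero
  · have h := QuasiHom.mem_weightIdeal.mp (hνlim 0) 0 (by simp)
    rw [hf0, map_sub, sub_eq_zero] at h
    rw [← MvPowerSeries.coeff_zero_eq_constantCoeff_apply, h]
    simp
  · have h := sub_eq_zero.mp (QuasiHom.residual_eq_zero_of_limit hFm hinv hΦlim hνlim hRlim i)
    rw [QuasiHom.fieldDeriv_apply, Finset.mul_sum] at h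
    refine Eq.trans (Finset.sum_congr rfl fun j _ => ?_) h
    ring
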